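/- Let $n \ge 1$, let $B_1$ be the open unit ball of $\mathbb{R}^n$, and let $\mathcal{A} = (a^{ij})$ be a measurable matrix-valued function on $B_1$ that is symmetric and strictly and uniformly elliptic, i.e. for some constants $\lambda > 0$ and $\Lambda$, for almost every $x \in B_1$ we have $a^{ij}(x) = a^{ji}(x)$ and $\lambda|\xi|^2 \le a^{ij}(x)\xi_i\xi_j \le \Lambda|\xi|^2$ for all $\xi \in \mathbb{R}^n$ (no further regularity of the coefficients is assumed). A solution of the obstacle problem $$a^{ij}D_{ij}w = \chi_{\{w>0\}} \quad \text{in } B_1 \qquad (*)$$ means a function $w \in W^{2,n}_{\mathrm{loc}}(B_1) \cap C^0(\overline{B_1})$ with $w \ge 0$ that satisfies the equation almost everywhere in $B_1$. (Weak Comparison Principle.) Let $w_1, w_2$ be solutions of $(*)$ and let $\varepsilon \in \mathbb{R}$. If $w_1 \le w_2 \le w_1 + \varepsilon$ on $\partial B_1$, then $w_1 \le w_2 \le w_1 + \varepsilon$ in $B_1$. (Uniqueness.) Consequently, a solution of $(*)$ with prescribed boundary values is unique: if $w_1, w_2$ are solutions of $(*)$ and $w_1 = \psi = w_2$ on $\partial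 B_1$ for some function $\psi$ on $\partial B_1$, then $w_1 = w_2$ on $\overline{B_1}$. -/

import Mathlib

open MeasureTheory Set Metric
open scoped ContDiff ENNReal

namespace NondivObstacle

/-- `g` is the weak partial derivative `∂u/∂x_i` of `u` in the open set `Ω ⊆ ℝⁿ`: both functions are
locally integrable in `Ω` and `∫_Ω u ∂_i φ = - ∫_Ω g φ` for every `φ ∈ C_c^∞(Ω)`. -/
structure IsWeakPartial {n : ℕ} (Ω : Set (EuclideanSpace ℝ (Fin n))) (i : Fin n)
    (u g : EuclideanSpace ℝ (Fin n) → ℝ) : Prop where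
  locallyIntegrableOn : LocallyIntegrableOn u Ω volume
  locallyIntegrableOn_deriv : LocallyIntegrableOn g Ω volume
  integral_eq : ∀ φ : EuclideanSpace ℝ (Fin n) → ℝ, ContDiff ℝ ∞ φ → HasCompactSupport φ →
    tsupport φ ⊆ Ω →
    ∫ x in Ω, u x * fderiv ℝ φ x (EuclideanSpace.single i 1) = - ∫ x in Ω, g x * φ x

/-- `f ∈ L^p_loc(Ω)`: `f` is in `L^p(K)` for every compact `K ⊆ Ω`. -/
def MemLpLoc {n : ℕ} (Ω : Set (EuclideanSpace ℝ (Fin n))) (p : ℝ≥0∞)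
    (f : EuclideanSpace ℝ (Fin n) → ℝ) : Prop :=
  ∀ K : Set (EuclideanSpace ℝ (Fin n)), IsCompact K → K ⊆ Ω → MemLp f p (volume.restrict K)

/-- `u ∈ W^{2,p}_loc(Ω)`, with weak gradient `G = (D_i u)` and weak Hessian `H = (D_ij u)`
(these are determined by `u` up to null sets in `Ω`). -/
structure HasW2LocDerivs {n : ℕ} (Ω : Set (EuclideanSpace ℝ (Fin n))) (p : ℝ≥0∞)
    (u : EuclideanSpace ℝ (Fin n) → ℝ) (G : Fin n → EuclideanSpace ℝ (Fin n) → ℝ)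
    (H : Fin n → Fin n → EuclideanSpace ℝ (Fin n) → ℝ) : Prop where
  memLpLoc : MemLpLoc Ω p u
  memLpLoc_grad : ∀ i, MemLpLoc Ω p (G i)
  memLpLoc_hess : ∀ i j, MemLpLoc Ω p (H i j)
  isWeakPartial_grad : ∀ i, IsWeakPartial Ω i u (G i)
  isWeakPartial_hess : ∀ i j, IsWeakPartial Ω j (G i) (H i j)

/-- The coefficient matrix `a = (a^{ij})` is measurable, symmetric and strictly and uniformly
elliptic in the unit ball with constants `lam`, `Lam`:
`0 < lam` and `lam |ξ|² ≤ a^{ij}(x) ξ_i ξ_j ≤ Lam |ξ|²` for all `ξ`, for almost every `x ∈ B_1`. -/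
structure IsUniformlyElliptic {n : ℕ} (lam Lam : ℝ)
    (a : EuclideanSpace ℝ (Fin n) → Matrix (Fin n) (Fin n) ℝ) : Prop where
  pos : 0 < lam
  aestronglyMeasurable : ∀ i j,
    AEStronglyMeasurable (fun x => a x i j) (volume.restrict (ball 0 1))
  isSymm : ∀ᵐ x ∂(volume.restrict (ball 0 1)), (a x).IsSymm
  bounds : ∀ᵐ x ∂(volume.restrict (ball 0 1)), ∀ ξ : EuclideanSpace ℝ (Fin n),
    lam * ‖ξ‖ ^ 2 ≤ ∑ i, ∑ j, a x i j * ξ i * ξ j ∧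
      ∑ i, ∑ j, a x i j * ξ i * ξ j ≤ Lam * ‖ξ‖ ^ 2

/-- `w` is a (nonnegative, continuous, strong) solution of the obstacle problem
`a^{ij} D_ij w = χ_{w > 0}` in the unit ball `B_1 ⊆ ℝⁿ`: it belongs to
`W^{2,n}_loc(B_1) ∩ C⁰(closure of B_1)`, it is nonnegative, and the equation holds almost everywhere
in `B_1`. Only the values of `w` on the closed ball matter. -/
structure IsSolution {n : ℕ} (a : EuclideanSpace ℝ (Fin n) → Matrix (Fin n) (Fin n) ℝ)
    (w : EuclideanSpace ℝ (Fin n) → ℝ) : Prop where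
  continuousOn : ContinuousOn w (closedBall 0 1)
  nonneg : ∀ x ∈ ball (0 : EuclideanSpace ℝ (Fin n)) 1, 0 ≤ w x
  strong : ∃ (G : Fin n → EuclideanSpace ℝ (Fin n) → ℝ)
      (H : Fin n → Fin n → EuclideanSpace ℝ (Fin n) → ℝ),
    HasW2LocDerivs (ball 0 1) (n : ℝ≥0∞) w G H ∧
    ∀ᵐ x ∂(volume.restrict (ball 0 1)),
      ∑ i, ∑ j, a x i j * H i j x = indicator {y | 0 < w y} (fun _ => (1 : ℝ)) x

end NondivObstacle

open Filter Topology Matrix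
open scoped Convolution

namespace NondivObstacle

/-! ### Linear algebra -/

/-! Where `v - w > c ≥ 0`, nonnegativity of `w` forces `v > 0`, so the equation gives `a^{ij} D_ij
(v - w) = 1 - χ_{w > 0} ≥ 0` almost everywhere. Both comparison inequalities thus reduce to a
maximum principle for strong subsolutions in `W^{2,n}_loc` whose differential inequality is known
only on `{u > c}` (`le_of_subsolution`), and uniqueness is comparison with `ε = 0`.

The maximum principle is of Alexandrov–Bakelman–Pucci type. If `u` exceeds `c` inside, its
mollifications `V` have an interior peak, so every small slope `p` is the gradient of `V` at a point
where `V` minus a linear function is maximal. The area formula then bounds the volume of a fixed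
ball of slopes by the integral of `det (-D²V)` over this contact set
(`volume_ball_le_lintegral_det_hess`).

At contact points `-D²V` is positive semidefinite, while the weak Hessian `H` of `u` satisfies
`a^{ij} H_ij ≥ 0`. Ellipticity therefore bounds the determinant by a multiple of `|D²V - H|^n`
(`det_neg_le`). Since `D²V` is the mollification of `H ∈ L^n_loc`, the integral tends to zero,
contradicting the positive volume of the ball. The coefficients are never mollified, so their
measurability suffices. -/

lemma det_le_trace_pow {n : ℕ} {A : Matrix (Fin n) (Fin n) ℝ} (hA : A.PosSemidef) :
    A.det ≤ A.trace ^ n := by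
  have hdet := hA.isHermitian.det_eq_prod_eigenvalues
  have htr := hA.isHermitian.trace_eq_sum_eigenvalues
  simp only [RCLike.ofReal_real_eq_id, id_eq] at hdet htr
  rw [hdet, htr]
  -- Each nonnegative eigenvalue is at most their sum; the sharper constant from AM–GM is not
  -- needed.
  calc ∏ i, hA.isHermitian.eigenvalues i
      ≤ ∏ _i : Fin n, ∑ j, hA.isHermitian.eigenvalues j :=
        Finset.prod_le_prod (fun i _ => hA.eigenvalues_nonneg i) fun i _ =>
          Finset.single_le_sum (fun j _ => hA.eigenvalues_nonneg j) (Finset.mem_univ i)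
    _ = _ := by simp

/-- A positive semidefinite matrix is a sum of rank-one matrices `v vᵀ`, and on each of them this is
the lower ellipticity bound at `ξ = v`. -/
lemma mul_trace_le_sum_mul {n : ℕ} {lam : ℝ} {A a : Matrix (Fin n) (Fin n) ℝ} (hA : A.PosSemidef)
    (ha : ∀ ξ : EuclideanSpace ℝ (Fin n), lam * ‖ξ‖ ^ 2 ≤ ∑ i, ∑ j, a i j * ξ i * ξ j) :
    lam * A.trace ≤ ∑ i, ∑ j, a i j * A i j := by
  obtain ⟨m, v, rfl⟩ := posSemidef_iff_eq_sum_vecMulVec.mp hA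
  have h1 : ∑ i, ∑ j, a i j * (∑ k, vecMulVec (v k) (star (v k))) i j
      = ∑ k, ∑ i, ∑ j, a i j * v k i * v k j := by
    simp only [Matrix.sum_apply, vecMulVec_apply, Finset.mul_sum, star_trivial]
    simp_rw [← mul_assoc]
    rw [eq_comm, Finset.sum_comm]
    exact Finset.sum_congr rfl fun i _ => Finset.sum_comm
  rw [h1, Matrix.trace_sum, Finset.mul_sum]
  refine Finset.sum_le_sum fun k _ => ?_
  have := ha (WithLp.toLp 2 (v k))
  rw [EuclideanSpace.norm_sq_eq] at this
  simpa [Matrix.trace, vecMulVec_apply, sq] using this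

/-- Polarization: the quadratic form at `e_i + e_j` minus that at `e_i - e_j` is `4 a_ij`, and both
values lie in `[0, 4 Lam]`. -/
lemma abs_coeff_le {n : ℕ} {lam Lam : ℝ} (hlam : 0 < lam) {a : Matrix (Fin n) (Fin n) ℝ}
    (hs : a.IsSymm)
    (ha : ∀ ξ : EuclideanSpace ℝ (Fin n), lam * ‖ξ‖ ^ 2 ≤ ∑ i, ∑ j, a i j * ξ i * ξ j ∧
      ∑ i, ∑ j, a i j * ξ i * ξ j ≤ Lam * ‖ξ‖ ^ 2) (i j : Fin n) : |a i j| ≤ Lam := by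
  have hB : ∀ ξ : EuclideanSpace ℝ (Fin n),
      ∑ i, ∑ j, a i j * ξ i * ξ j = (ξ : Fin n → ℝ) ⬝ᵥ (a *ᵥ (ξ : Fin n → ℝ)) := by
    intro ξ
    simp only [dotProduct, mulVec, Finset.mul_sum]
    exact Finset.sum_congr rfl fun i _ => Finset.sum_congr rfl fun j _ => by ring
  set e : Fin n → EuclideanSpace ℝ (Fin n) := fun i => EuclideanSpace.single i 1
  have hL : 0 ≤ Lam := by
    have h := ha (e i)
    have h2 : ‖e i‖ = 1 := by simp [e]
    rw [h2] at h
    nlinarith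
  -- The bound 4, rather than 2, also covers `i = j`.
  have he : ∀ s : ℝ, |s| ≤ 1 → ‖e i + s • e j‖ ^ 2 ≤ 4 := by
    intro s hs
    have : ‖e i + s • e j‖ ≤ 2 := by
      refine (norm_add_le _ _).trans ?_
      rw [norm_smul]
      simp only [e, PiLp.norm_single, norm_one, mul_one, Real.norm_eq_abs]
      linarith
    nlinarith [norm_nonneg (e i + s • e j)]
  have hq : ∀ s : ℝ, ∑ k, ∑ l, a k l * (e i + s • e j) k * (e i + s • e j) l
      = a i i + 2 * s * a i j + s ^ 2 * a j j := by
    intro s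
    rw [hB]
    have : ((e i + s • e j : EuclideanSpace ℝ (Fin n)) : Fin n → ℝ)
      = Pi.single i 1 + s • Pi.single j 1 := by
      ext k; simp [e, Pi.single_apply]
    rw [this]
    simp only [mulVec_add, mulVec_smul, dotProduct_add, add_dotProduct, smul_dotProduct,
      dotProduct_smul, single_one_dotProduct, mulVec_single_one, smul_eq_mul, Matrix.col_apply]
    rw [hs.apply i j]
    ring
  have h1 := ha (e i + (1 : ℝ) • e j)
  have h2 := ha (e i + (-1 : ℝ) • e j)
  rw [hq] at h1 h2
  have h3 := he 1 (by simp)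
  have h4 := he (-1) (by simp)
  have h5 : 0 ≤ lam * ‖e i + (1 : ℝ) • e j‖ ^ 2 := by positivity
  have h6 : 0 ≤ lam * ‖e i + (-1 : ℝ) • e j‖ ^ 2 := by positivity
  have h7 : Lam * ‖e i + (1 : ℝ) • e j‖ ^ 2 ≤ Lam * 4 := by gcongr
  have h8 : Lam * ‖e i + (-1 : ℝ) • e j‖ ^ 2 ≤ Lam * 4 := by gcongr
  rw [abs_le]
  constructor <;> linarith

/-- If `-B` is positive semidefinite and `a^{ij} H_ij ≥ 0`, then `det (-B)` is controlled by the
distance between `B` and `H`. -/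
lemma det_neg_le {n : ℕ} {lam Lam : ℝ} (hlam : 0 < lam) {a B H : Matrix (Fin n) (Fin n) ℝ}
    (hs : a.IsSymm)
    (ha : ∀ ξ : EuclideanSpace ℝ (Fin n), lam * ‖ξ‖ ^ 2 ≤ ∑ i, ∑ j, a i j * ξ i * ξ j ∧
      ∑ i, ∑ j, a i j * ξ i * ξ j ≤ Lam * ‖ξ‖ ^ 2)
    (hB : (-B).PosSemidef) (hH : 0 ≤ ∑ i, ∑ j, a i j * H i j) :
    (-B).det ≤ (Lam / lam * ∑ i, ∑ j, |B i j - H i j|) ^ n := by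
  refine (det_le_trace_pow hB).trans (pow_le_pow_left₀ hB.trace_nonneg ?_ n)
  rw [div_mul_eq_mul_div, le_div_iff₀ hlam, mul_comm]
  -- Adding the nonnegative `a^{ij} H_ij` turns `-a^{ij} B_ij` into an expression in `B - H` alone.
  calc lam * (-B).trace ≤ ∑ i, ∑ j, a i j * (-B) i j :=
        mul_trace_le_sum_mul hB fun ξ => (ha ξ).1
    _ ≤ ∑ i, ∑ j, a i j * (-B) i j + ∑ i, ∑ j, a i j * H i j := le_add_of_nonneg_right hH
    _ = ∑ i, ∑ j, a i j * -(B i j - H i j) := by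
        simp only [← Finset.sum_add_distrib, Matrix.neg_apply]
        exact Finset.sum_congr rfl fun i _ => Finset.sum_congr rfl fun j _ => by ring
    _ ≤ ∑ i, ∑ j, Lam * |B i j - H i j| := by
        refine Finset.sum_le_sum fun i _ => Finset.sum_le_sum fun j _ => ?_
        refine (le_abs_self _).trans ?_
        rw [abs_mul, abs_neg]
        gcongr
        exact abs_coeff_le hlam hs ha i j
    _ = _ := by simp only [Finset.mul_sum]

/-! ### Second derivatives at a maximum -/

/-- A positive second derivative would make `x` a local minimum as well, so `f` would be locally
constant and the second derivative zero. -/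
lemma deriv_deriv_nonpos_of_isLocalMax {f : ℝ → ℝ} {x : ℝ} (h : IsLocalMax f x)
    (hc : ContinuousAt f x) : deriv (deriv f) x ≤ 0 := by
  by_contra! hpos
  have hmin := isLocalMin_of_deriv_deriv_pos hpos h.deriv_eq_zero hc
  have hconst : f =ᶠ[𝓝 x] fun _ => f x := by
    filter_upwards [h, hmin] with y h1 h2 using le_antisymm h1 h2
  have h1 : deriv f =ᶠ[𝓝 x] fun _ => 0 := by
    filter_upwards [hconst.eventuallyEq_nhds] with y hy
    rw [hy.deriv_eq, deriv_const]
  rw [h1.deriv_eq, deriv_const] at hpos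
  exact lt_irrefl _ hpos

end NondivObstacle

namespace NondivObstacle

/-! ### Mollification -/

variable {n : ℕ}

/-- The convolution of `h` with the normalized bump function `φ`. -/
noncomputable def mollify (φ : ContDiffBump (0 : EuclideanSpace ℝ (Fin n)))
    (h : EuclideanSpace ℝ (Fin n) → ℝ) : EuclideanSpace ℝ (Fin n) → ℝ :=
  φ.normed volume ⋆[ContinuousLinearMap.lsmul ℝ ℝ, volume] h

lemma mollify_congr_ae (φ : ContDiffBump (0 : EuclideanSpace ℝ (Fin n)))
    {h h' : EuclideanSpace ℝ (Fin n) → ℝ} (hh : h =ᵐ[volume] h') : mollify φ h = mollify φ h' :=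
  convolution_congr _ ae_eq_rfl hh

/-- The kernel is a probability density, so Jensen bounds the `p`-th power of the average by the
average of `p`-th powers; Tonelli and translation invariance finish. -/
lemma eLpNorm_mollify_le {p : ℝ≥0∞} (hp1 : 1 ≤ p) (hp : p ≠ ⊤)
    (φ : ContDiffBump (0 : EuclideanSpace ℝ (Fin n))) {h : EuclideanSpace ℝ (Fin n) → ℝ}
    (hh : AEStronglyMeasurable h volume) :
    eLpNorm (mollify φ h) p volume ≤ eLpNorm h p volume := by
  wlog hm : Measurable h generalizing h
  · rw [mollify_congr_ae φ hh.ae_eq_mk, eLpNorm_congr_ae hh.ae_eq_mk]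
    exact this hh.stronglyMeasurable_mk.aestronglyMeasurable hh.stronglyMeasurable_mk.measurable
  have hφm : Measurable fun t => ‖φ.normed volume t‖ₑ := φ.continuous_normed.measurable.enorm
  set μ : Measure (EuclideanSpace ℝ (Fin n)) :=
    volume.withDensity fun t => ‖φ.normed volume t‖ₑ with hμ
  have hprob : IsProbabilityMeasure μ := by
    refine ⟨?_⟩
    rw [hμ, withDensity_apply _ MeasurableSet.univ, Measure.restrict_univ]
    have h1 : ∀ t, ‖φ.normed volume t‖ₑ = ENNReal.ofReal (φ.normed volume t) := fun t =>
      Real.enorm_of_nonneg (φ.nonneg_normed t)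
    simp_rw [h1]
    rw [← ofReal_integral_eq_lintegral_ofReal φ.integrable_normed
      (Eventually.of_forall φ.nonneg_normed), φ.integral_normed, ENNReal.ofReal_one]
  have hp0 : p ≠ 0 := (zero_lt_one.trans_le hp1).ne'
  have hq : 0 < p.toReal := ENNReal.toReal_pos hp0 hp
  have hpt : ∀ x, ‖mollify φ h x‖ₑ ^ p.toReal ≤ ∫⁻ t, ‖h (x - t)‖ₑ ^ p.toReal ∂μ := by
    intro x
    have hmx : Measurable fun t => h (x - t) := hm.comp (measurable_const.sub measurable_id)
    have h1 : ‖mollify φ h x‖ₑ ≤ eLpNorm (fun t => h (x - t)) 1 μ := by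
      rw [eLpNorm_one_eq_lintegral_enorm, hμ,
        lintegral_withDensity_eq_lintegral_mul _ hφm hmx.enorm]
      refine (enorm_integral_le_lintegral_enorm _).trans (le_of_eq ?_)
      simp
    have h2 := h1.trans (eLpNorm_le_eLpNorm_of_exponent_le hp1 hmx.aestronglyMeasurable)
    rw [eLpNorm_eq_lintegral_rpow_enorm_toReal hp0 hp, one_div] at h2
    exact (ENNReal.le_rpow_inv_iff hq).1 h2
  rw [eLpNorm_eq_lintegral_rpow_enorm_toReal hp0 hp, eLpNorm_eq_lintegral_rpow_enorm_toReal hp0 hp]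
  gcongr ?_ ^ _
  calc ∫⁻ x, ‖mollify φ h x‖ₑ ^ p.toReal
      ≤ ∫⁻ x, ∫⁻ t, ‖h (x - t)‖ₑ ^ p.toReal ∂μ := lintegral_mono hpt
    _ = ∫⁻ t, (∫⁻ x, ‖h (x - t)‖ₑ ^ p.toReal) ∂μ := by
        refine lintegral_lintegral_swap (Measurable.aemeasurable ?_)
        exact (hm.comp (measurable_fst.sub measurable_snd)).enorm.pow_const _
    _ = ∫⁻ _t, (∫⁻ x, ‖h x‖ₑ ^ p.toReal) ∂μ := by
        refine lintegral_congr fun t => ?_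
        exact lintegral_sub_right_eq_self (fun x => ‖h x‖ₑ ^ p.toReal) t
    _ = ∫⁻ x, ‖h x‖ₑ ^ p.toReal := by simp

lemma contDiff_mollify (φ : ContDiffBump (0 : EuclideanSpace ℝ (Fin n)))
    {h : EuclideanSpace ℝ (Fin n) → ℝ} (hh : LocallyIntegrable h volume) :
    ContDiff ℝ ∞ (mollify φ h) :=
  φ.hasCompactSupport_normed.contDiff_convolution_left _ φ.contDiff_normed hh

lemma mollify_sub (φ : ContDiffBump (0 : EuclideanSpace ℝ (Fin n)))
    {g h : EuclideanSpace ℝ (Fin n) → ℝ} (hg : LocallyIntegrable g volume)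
    (hh : LocallyIntegrable h volume) : mollify φ (g - h) = mollify φ g - mollify φ h := by
  have hex : ∀ {f : EuclideanSpace ℝ (Fin n) → ℝ}, LocallyIntegrable f volume →
      ∀ x, ConvolutionExistsAt (φ.normed volume) f x (ContinuousLinearMap.lsmul ℝ ℝ) volume :=
    fun hf x => φ.hasCompactSupport_normed.convolutionExists_left _ φ.continuous_normed hf x
  ext x
  simp only [mollify, convolution_def, Pi.sub_apply, map_sub]
  exact integral_sub (hex hg x) (hex hh x)

/-- Mollifications of `h ∈ L^p` converge to `h` in `L^p` on sets of finite measure. -/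
lemma tendsto_eLpNorm_mollify_sub {p : ℝ≥0∞} (hp1 : 1 ≤ p) (hp : p ≠ ⊤)
    {φ : ℕ → ContDiffBump (0 : EuclideanSpace ℝ (Fin n))}
    (hφ : Tendsto (fun k => (φ k).rOut) atTop (𝓝 0)) {h : EuclideanSpace ℝ (Fin n) → ℝ}
    (hh : MemLp h p volume) {K : Set (EuclideanSpace ℝ (Fin n))} (hK : volume K ≠ ⊤) :
    Tendsto (fun k => eLpNorm (mollify (φ k) h - h) p (volume.restrict K)) atTop (𝓝 0) := by
  rw [ENNReal.tendsto_nhds_zero]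
  intro ε hε
  wlog hεt : ε ≠ ⊤ generalizing ε
  · rw [not_ne_iff.1 hεt]
    exact Eventually.of_forall fun _ => le_top
  have hε3 : ε / 3 ≠ 0 := (ENNReal.div_pos hε.ne' (by simp)).ne'
  -- For `g` continuous with compact support the mollification converges uniformly, hence in `L^p`
  -- on the finite-measure set `K`; the two errors from `h - g` are controlled by the `L^p`
  -- contraction.
  obtain ⟨g, hgc, hgh, hgcont, hgp⟩ := hh.exists_hasCompactSupport_eLpNorm_sub_le hp hε3
  obtain ⟨δ, hδ, hδK⟩ : ∃ δ : ℝ, 0 < δ ∧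
      volume K ^ p.toReal⁻¹ * ENNReal.ofReal δ ≤ ε / 3 := by
    have hfin : volume K ^ p.toReal⁻¹ ≠ ⊤ :=
      ENNReal.rpow_ne_top_of_nonneg (by positivity) hK
    have : Tendsto (fun δ : ℝ => volume K ^ p.toReal⁻¹ * ENNReal.ofReal δ) (𝓝[>] 0) (𝓝 0) := by
      have h0 : Tendsto (fun δ : ℝ => ENNReal.ofReal δ) (𝓝[>] 0) (𝓝 0) := by
        have := (ENNReal.continuous_ofReal.tendsto 0).mono_left
          (nhdsWithin_le_nhds (s := Ioi (0 : ℝ)))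
        simpa using this
      simpa using ENNReal.Tendsto.const_mul h0 (Or.inr hfin)
    obtain ⟨δ, h1, h2⟩ := ((ENNReal.tendsto_nhds_zero.1 this (ε / 3) (pos_iff_ne_zero.2 hε3)).and
      self_mem_nhdsWithin).exists
    exact ⟨δ, h2, h1⟩
  obtain ⟨η, hη, hgu⟩ := Metric.uniformContinuous_iff.1
    (hgc.uniformContinuous_of_continuous hgcont) δ hδ
  have hhi : LocallyIntegrable h volume := hh.locallyIntegrable hp1
  have hgi : LocallyIntegrable g volume := hgp.locallyIntegrable hp1
  filter_upwards [hφ.eventually (gt_mem_nhds hη)] with k hk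
  have hsplit : mollify (φ k) h - h
      = mollify (φ k) (h - g) + (mollify (φ k) g - g) - (h - g) := by
    rw [mollify_sub _ hhi hgi]; abel
  have hm1 : AEStronglyMeasurable (mollify (φ k) (h - g)) (volume.restrict K) :=
    (contDiff_mollify _ (hhi.sub hgi)).continuous.aestronglyMeasurable
  have hm2 : AEStronglyMeasurable (mollify (φ k) g - g) (volume.restrict K) :=
    ((contDiff_mollify _ hgi).continuous.sub hgcont).aestronglyMeasurable
  have hm3 : AEStronglyMeasurable (h - g) (volume.restrict K) :=
    (hh.sub hgp).aestronglyMeasurable.restrict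
  have hbound : eLpNorm (mollify (φ k) g - g) p (volume.restrict K) ≤ ε / 3 := by
    refine (eLpNorm_le_of_ae_bound (C := δ) (Eventually.of_forall fun x => ?_)).trans ?_
    · rw [Pi.sub_apply, ← dist_eq_norm]
      exact (φ k).dist_normed_convolution_le hgcont.aestronglyMeasurable
        fun y hy => (hgu ((mem_ball.1 hy).trans hk)).le
    · rwa [Measure.restrict_apply_univ]
  calc eLpNorm (mollify (φ k) h - h) p (volume.restrict K)
      ≤ eLpNorm (mollify (φ k) (h - g) + (mollify (φ k) g - g)) p (volume.restrict K)
          + eLpNorm (h - g) p (volume.restrict K) := by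
        rw [hsplit]; exact eLpNorm_sub_le (hm1.add hm2) hm3 hp1
    _ ≤ (eLpNorm (mollify (φ k) (h - g)) p (volume.restrict K)
          + eLpNorm (mollify (φ k) g - g) p (volume.restrict K))
          + eLpNorm (h - g) p (volume.restrict K) := by
        gcongr; exact eLpNorm_add_le hm1 hm2 hp1
    _ ≤ (ε / 3 + ε / 3) + ε / 3 := by
        have h1 : eLpNorm (h - g) p (volume.restrict K) ≤ ε / 3 :=
          (eLpNorm_mono_measure _ Measure.restrict_le_self).trans hgh
        have h2 : eLpNorm (mollify (φ k) (h - g)) p (volume.restrict K) ≤ ε / 3 :=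
          (eLpNorm_mono_measure _ Measure.restrict_le_self).trans
            ((eLpNorm_mollify_le hp1 hp _ (hh.sub hgp).aestronglyMeasurable).trans hgh)
        gcongr
    _ = ε := ENNReal.add_thirds ε

/-- On points whose `φ.rOut`-neighbourhood stays in `closedBall 0 ρ`, the partial derivatives of the
mollification of `u` are the mollifications of the weak partial derivatives. -/
lemma fderiv_mollify_indicator {Ω : Set (EuclideanSpace ℝ (Fin n))} (hΩ : MeasurableSet Ω)
    {i : Fin n} {u g : EuclideanSpace ℝ (Fin n) → ℝ} (hu : IsWeakPartial Ω i u g) {ρ : ℝ}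
    (hρ : closedBall 0 ρ ⊆ Ω) (φ : ContDiffBump (0 : EuclideanSpace ℝ (Fin n)))
    {x : EuclideanSpace ℝ (Fin n)} (hx : ‖x‖ + φ.rOut ≤ ρ) :
    fderiv ℝ (mollify φ (indicator (closedBall 0 ρ) u)) x (EuclideanSpace.single i 1)
      = mollify φ (indicator (closedBall 0 ρ) g) x := by
  have hui : Integrable (indicator (closedBall 0 ρ) u) volume :=
    (integrable_indicator_iff measurableSet_closedBall).2
      (hu.locallyIntegrableOn.integrableOn_compact_subset hρ (isCompact_closedBall _ _))
  have hcd : ContDiff ℝ 1 (φ.normed volume) := φ.contDiff_normed (n := 1)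
  have hfd := (φ.hasCompactSupport_normed (μ := volume)).hasFDerivAt_convolution_left
    (ContinuousLinearMap.lsmul ℝ ℝ) hcd hui.locallyIntegrable x
  have hsupp : closedBall x φ.rOut ⊆ closedBall 0 ρ := closedBall_subset_closedBall' (by
    rw [dist_zero_right]; linarith)
  have hts : tsupport (fun y => φ.normed volume (x - y)) ⊆ closedBall x φ.rOut := by
    refine closure_minimal (fun y hy => ?_) isClosed_closedBall
    have : x - y ∈ Function.support (φ.normed volume) := hy
    rw [φ.support_normed_eq, mem_ball_zero_iff] at this
    rw [mem_closedBall, dist_comm, dist_eq_norm]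
    exact this.le
  have hψ : ContDiff ℝ ∞ (fun y => φ.normed volume (x - y)) :=
    φ.contDiff_normed.comp (contDiff_const.sub contDiff_id)
  have hψc : HasCompactSupport (fun y => φ.normed volume (x - y)) :=
    HasCompactSupport.of_support_subset_isCompact (isCompact_closedBall x φ.rOut)
      ((subset_tsupport _).trans hts)
  -- The test function is the reflected kernel `y ↦ φ(x - y)`, whose support lies where the
  -- truncation has no effect. The sign from the reflection cancels the one in the weak derivative.
  have key := hu.integral_eq _ hψ hψc (hts.trans (hsupp.trans hρ))
  have hderiv : ∀ y, fderiv ℝ (fun y => φ.normed volume (x - y)) y (EuclideanSpace.single i 1)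
      = - fderiv ℝ (φ.normed volume) (x - y) (EuclideanSpace.single i 1) := by
    intro y
    have h1 := ((hcd.differentiable one_ne_zero) (x - y)).hasFDerivAt.comp y
      ((hasFDerivAt_const x y).sub (hasFDerivAt_id y))
    exact (DFunLike.congr_fun h1.fderiv _).trans (by simp)
  have hL : fderiv ℝ (mollify φ (indicator (closedBall 0 ρ) u)) x (EuclideanSpace.single i 1)
      = ∫ y, fderiv ℝ (φ.normed volume) (x - y) (EuclideanSpace.single i 1)
          * indicator (closedBall 0 ρ) u y := by
    have hex := (φ.hasCompactSupport_normed (μ := volume)).fderiv (𝕜 := ℝ)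
      |>.convolutionExists_left
        ((ContinuousLinearMap.lsmul ℝ ℝ : ℝ →L[ℝ] ℝ →L[ℝ] ℝ).precompL (EuclideanSpace ℝ (Fin n)))
        (hcd.continuous_fderiv one_ne_zero) hui.locallyIntegrable x
    rw [mollify, hfd.fderiv, convolution_def, ContinuousLinearMap.integral_apply hex,
      ← integral_sub_left_eq_self _ volume x]
    simp [ContinuousLinearMap.precompL_apply]
  have hzero : ∀ y ∉ closedBall x φ.rOut, φ.normed volume (x - y) = 0 := fun y hy =>
    image_eq_zero_of_notMem_tsupport (f := fun y => φ.normed volume (x - y)) fun h => hy (hts h)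
  have hzero' : ∀ y ∉ closedBall x φ.rOut,
      fderiv ℝ (φ.normed volume) (x - y) (EuclideanSpace.single i 1) = 0 := by
    intro y hy
    have h1 : fderiv ℝ (fun y => φ.normed volume (x - y)) y = 0 :=
      image_eq_zero_of_notMem_tsupport (f := fderiv ℝ (fun y => φ.normed volume (x - y)))
        fun h => hy (hts (tsupport_fderiv_subset ℝ h))
    have h2 := hderiv y
    rw [h1] at h2
    simpa using h2.symm
  have hR : mollify φ (indicator (closedBall 0 ρ) g) x
      = ∫ y, φ.normed volume (x - y) * indicator (closedBall 0 ρ) g y := by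
    rw [mollify, convolution_lsmul_swap]; simp
  have hind : ∀ (f k : EuclideanSpace ℝ (Fin n) → ℝ), (∀ y ∉ closedBall x φ.rOut, f y = 0) →
      ∫ y in Ω, k y * f y = ∫ y, f y * indicator (closedBall 0 ρ) k y := by
    intro f k hf
    rw [← integral_indicator hΩ]
    refine integral_congr_ae (Eventually.of_forall fun y => ?_)
    by_cases hy : y ∈ closedBall x φ.rOut
    · simp only [indicator_of_mem (hsupp hy), indicator_of_mem (hρ (hsupp hy)), mul_comm]
    · simp [hf y hy]
  rw [hL, hR, ← hind _ u hzero', ← hind _ g hzero, ← neg_inj, ← key, ← integral_neg]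
  simp_rw [hderiv, mul_neg]

end NondivObstacle

namespace NondivObstacle

/-! ### Differences of weakly differentiable functions -/

variable {n : ℕ}

lemma integrableOn_mul_of_tsupport_subset {Ω : Set (EuclideanSpace ℝ (Fin n))}
    {u ψ : EuclideanSpace ℝ (Fin n) → ℝ} (hu : LocallyIntegrableOn u Ω volume) (hψ : Continuous ψ)
    (hc : HasCompactSupport ψ) (hs : tsupport ψ ⊆ Ω) :
    IntegrableOn (fun x => u x * ψ x) Ω volume := by
  have h1 : IntegrableOn (fun x => u x * ψ x) (tsupport ψ) volume :=
    (hu.integrableOn_compact_subset hs hc).mul_continuousOn hψ.continuousOn hc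
  refine (Integrable.integrableOn ?_)
  refine (integrableOn_iff_integrable_of_support_subset fun x hx => ?_).1 h1
  exact subset_tsupport _ (right_ne_zero_of_mul hx)

lemma IsWeakPartial.sub {Ω : Set (EuclideanSpace ℝ (Fin n))} {i : Fin n}
    {u v g h : EuclideanSpace ℝ (Fin n) → ℝ} (hu : IsWeakPartial Ω i u g)
    (hv : IsWeakPartial Ω i v h) : IsWeakPartial Ω i (u - v) (g - h) where
  locallyIntegrableOn := hu.locallyIntegrableOn.sub hv.locallyIntegrableOn
  locallyIntegrableOn_deriv := hu.locallyIntegrableOn_deriv.sub hv.locallyIntegrableOn_deriv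
  integral_eq φ hφ hc hs := by
    have hd : Continuous fun x => fderiv ℝ φ x (EuclideanSpace.single i 1) :=
      (hφ.continuous_fderiv (by simp)).clm_apply continuous_const
    have hdt : tsupport (fun x => fderiv ℝ φ x (EuclideanSpace.single i 1)) ⊆ tsupport φ :=
      tsupport_fderiv_apply_subset ℝ _
    have hdc : HasCompactSupport fun x => fderiv ℝ φ x (EuclideanSpace.single i 1) :=
      hc.fderiv_apply (𝕜 := ℝ) _
    have hi : ∀ {w : EuclideanSpace ℝ (Fin n) → ℝ}, LocallyIntegrableOn w Ω volume →
        Integrable (fun x => w x * fderiv ℝ φ x (EuclideanSpace.single i 1))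
          (volume.restrict Ω) :=
      fun hw => integrableOn_mul_of_tsupport_subset hw hd hdc (hdt.trans hs)
    have hi' : ∀ {w : EuclideanSpace ℝ (Fin n) → ℝ}, LocallyIntegrableOn w Ω volume →
        Integrable (fun x => w x * φ x) (volume.restrict Ω) :=
      fun hw => integrableOn_mul_of_tsupport_subset hw hφ.continuous hc hs
    simp only [Pi.sub_apply, sub_mul]
    rw [integral_sub (hi hu.locallyIntegrableOn) (hi hv.locallyIntegrableOn),
      integral_sub (hi' hu.locallyIntegrableOn_deriv) (hi' hv.locallyIntegrableOn_deriv),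
      hu.integral_eq φ hφ hc hs, hv.integral_eq φ hφ hc hs]
    ring

lemma HasW2LocDerivs.sub {Ω : Set (EuclideanSpace ℝ (Fin n))} {p : ℝ≥0∞}
    {u v : EuclideanSpace ℝ (Fin n) → ℝ} {G G' : Fin n → EuclideanSpace ℝ (Fin n) → ℝ}
    {H H' : Fin n → Fin n → EuclideanSpace ℝ (Fin n) → ℝ}
    (hu : HasW2LocDerivs Ω p u G H) (hv : HasW2LocDerivs Ω p v G' H') :
    HasW2LocDerivs Ω p (u - v) (G - G') (H - H') where
  memLpLoc K hK hKΩ := (hu.memLpLoc K hK hKΩ).sub (hv.memLpLoc K hK hKΩ)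
  memLpLoc_grad i K hK hKΩ := (hu.memLpLoc_grad i K hK hKΩ).sub (hv.memLpLoc_grad i K hK hKΩ)
  memLpLoc_hess i j K hK hKΩ :=
    (hu.memLpLoc_hess i j K hK hKΩ).sub (hv.memLpLoc_hess i j K hK hKΩ)
  isWeakPartial_grad i := (hu.isWeakPartial_grad i).sub (hv.isWeakPartial_grad i)
  isWeakPartial_hess i j := (hu.isWeakPartial_hess i j).sub (hv.isWeakPartial_hess i j)

/-! ### The contact set of a smooth function -/

/-- The matrix of second partial derivatives. -/
noncomputable def hess (V : EuclideanSpace ℝ (Fin n) → ℝ) (x : EuclideanSpace ℝ (Fin n)) :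
    Matrix (Fin n) (Fin n) ℝ :=
  Matrix.of fun i j =>
    fderiv ℝ (fun y => fderiv ℝ V y (EuclideanSpace.single i 1)) x (EuclideanSpace.single j 1)

lemma hess_apply {V : EuclideanSpace ℝ (Fin n) → ℝ} (hV : ContDiff ℝ ∞ V)
    (x : EuclideanSpace ℝ (Fin n)) (i j : Fin n) :
    hess V x i j
      = fderiv ℝ (fderiv ℝ V) x (EuclideanSpace.single j 1) (EuclideanSpace.single i 1) := by
  have hd : DifferentiableAt ℝ (fderiv ℝ V) x :=
    ((hV.fderiv_right (m := 1) (by norm_cast)).differentiable one_ne_zero) x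
  simp only [hess, Matrix.of_apply]
  rw [fderiv_clm_apply hd (differentiableAt_const _)]
  simp

lemma continuous_hess {V : EuclideanSpace ℝ (Fin n) → ℝ} (hV : ContDiff ℝ ∞ V) :
    Continuous (hess V) := by
  refine continuous_matrix fun i j => ?_
  simp_rw [hess_apply hV]
  have : Continuous (fderiv ℝ (fderiv ℝ V)) :=
    (hV.fderiv_right (m := 1) (by norm_cast)).continuous_fderiv one_ne_zero
  exact (this.clm_apply continuous_const).clm_apply continuous_const

lemma isHermitian_hess {V : EuclideanSpace ℝ (Fin n) → ℝ} (hV : ContDiff ℝ ∞ V)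
    (x : EuclideanSpace ℝ (Fin n)) : (hess V x).IsHermitian := by
  ext i j
  rw [conjTranspose_apply, star_trivial, hess_apply hV, hess_apply hV]
  have h : IsSymmSndFDerivAt ℝ V x :=
    hV.contDiffAt.isSymmSndFDerivAt (by simp only [minSmoothness_of_isRCLikeNormedField]; norm_cast)
  exact h _ _

lemma dotProduct_hess_mulVec {V : EuclideanSpace ℝ (Fin n) → ℝ} (hV : ContDiff ℝ ∞ V)
    (x : EuclideanSpace ℝ (Fin n)) (ξ : Fin n → ℝ) :
    ξ ⬝ᵥ (hess V x *ᵥ ξ) = fderiv ℝ (fderiv ℝ V) x (WithLp.toLp 2 ξ) (WithLp.toLp 2 ξ) := by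
  have hξ : WithLp.toLp 2 ξ = ∑ i, ξ i • (EuclideanSpace.single i (1 : ℝ)) := by
    ext k; simp [Pi.single_apply]
  rw [hξ]
  simp only [dotProduct, mulVec, hess_apply hV, map_sum, map_smul,
    _root_.sum_apply, _root_.smul_apply, smul_eq_mul, Finset.mul_sum]
  exact Finset.sum_congr rfl fun i _ => Finset.sum_congr rfl fun j _ => by ring

/-- Along a line through `x` the subtracted linear term has no second derivative, so the
one-variable test applies in every direction. -/
lemma posSemidef_neg_hess_of_isLocalMax {V : EuclideanSpace ℝ (Fin n) → ℝ} (hV : ContDiff ℝ ∞ V)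
    {x : EuclideanSpace ℝ (Fin n)} (L : EuclideanSpace ℝ (Fin n) →L[ℝ] ℝ)
    (hx : IsLocalMax (fun y => V y - L y) x) : (-hess V x).PosSemidef := by
  refine PosSemidef.of_dotProduct_mulVec_nonneg (isHermitian_hess hV x).neg fun ξ => ?_
  rw [neg_mulVec, dotProduct_neg, star_trivial, dotProduct_hess_mulVec hV, neg_nonneg]
  generalize (WithLp.toLp 2 ξ : EuclideanSpace ℝ (Fin n)) = v
  have hline : ∀ t : ℝ, HasDerivAt (fun t : ℝ => x + t • v) v t := fun t => by
    simpa using ((hasDerivAt_id t).smul_const v).const_add x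
  have hVd : ∀ y, HasFDerivAt V (fderiv ℝ V y) y := fun y =>
    (hV.differentiable (by simp) y).hasFDerivAt
  have hd1 : ∀ t : ℝ, HasDerivAt (fun t : ℝ => V (x + t • v) - L (x + t • v))
      (fderiv ℝ V (x + t • v) v - L v) t := fun t => by
    have h1 : HasDerivAt (fun t : ℝ => V (x + t • v)) (fderiv ℝ V (x + t • v) v) t :=
      (hVd _).comp_hasDerivAt t (hline t)
    have h2 : HasDerivAt (fun t : ℝ => L (x + t • v)) (L v) t :=
      L.hasFDerivAt.comp_hasDerivAt t (hline t)
    exact h1.sub h2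
  have hVd2 : HasFDerivAt (fderiv ℝ V) (fderiv ℝ (fderiv ℝ V) x) (x + (0 : ℝ) • v) := by
    rw [zero_smul, add_zero]
    exact ((hV.fderiv_right (m := 1) (by norm_cast)).differentiable one_ne_zero x).hasFDerivAt
  have hd2 : HasDerivAt (fun t : ℝ => fderiv ℝ V (x + t • v) v - L v)
      (fderiv ℝ (fderiv ℝ V) x v v) 0 := by
    have h1 : HasDerivAt (fun t : ℝ => fderiv ℝ V (x + t • v)) (fderiv ℝ (fderiv ℝ V) x v) 0 :=
      hVd2.comp_hasDerivAt (0 : ℝ) (hline 0)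
    have h2 : HasDerivAt (fun t : ℝ => fderiv ℝ V (x + t • v) v)
        (fderiv ℝ (fderiv ℝ V) x v v) 0 := by
      simpa using h1.clm_apply (hasDerivAt_const (0 : ℝ) v)
    exact h2.sub_const (L v)
  have hmax : IsLocalMax (fun t : ℝ => V (x + t • v) - L (x + t • v)) 0 := by
    have hc : Tendsto (fun t : ℝ => x + t • v) (𝓝 0) (𝓝 x) := by
      simpa using (hline 0).continuousAt.tendsto
    filter_upwards [hc.eventually hx] with t ht
    simpa using ht
  have h := deriv_deriv_nonpos_of_isLocalMax hmax (hd1 0).continuousAt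
  rwa [funext fun t => (hd1 t).deriv, hd2.deriv] at h

/-- The slopes of small norm are attained, as gradients, at interior contact points with a plane. -/
lemma exists_contact_point {V : EuclideanSpace ℝ (Fin n) → ℝ} (hV : ContDiff ℝ ∞ V) {ρ b r : ℝ}
    (hρ : ρ ≤ 1) {x₀ : EuclideanSpace ℝ (Fin n)} (hx₀ : x₀ ∈ ball 0 ρ)
    (hb : ∀ y ∈ sphere 0 ρ, V y ≤ b) (hbr : b + 2 * r ≤ V x₀) {p : EuclideanSpace ℝ (Fin n)}
    (hp : ‖p‖ < r) :
    ∃ x ∈ ball 0 ρ, V x₀ - 2 * r ≤ V x ∧ (-hess V x).PosSemidef ∧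
      fderiv ℝ V x = innerSL ℝ p := by
  have hbd : ∀ y ∈ closedBall (0 : EuclideanSpace ℝ (Fin n)) ρ, |innerSL ℝ p y| ≤ ‖p‖ := by
    intro y hy
    rw [mem_closedBall_zero_iff] at hy
    refine (abs_real_inner_le_norm p y).trans ?_
    nlinarith [norm_nonneg p]
  obtain ⟨x, hx, hmax⟩ := (isCompact_closedBall (0 : EuclideanSpace ℝ (Fin n)) ρ).exists_isMaxOn
    ⟨x₀, ball_subset_closedBall hx₀⟩
    (hV.continuous.sub (innerSL ℝ p).continuous).continuousOn
  have h0 : V x₀ - innerSL ℝ p x₀ ≤ V x - innerSL ℝ p x := hmax (ball_subset_closedBall hx₀)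
  have h1 := abs_le.1 (hbd x hx)
  have h2 := abs_le.1 (hbd x₀ (ball_subset_closedBall hx₀))
  -- On a ball of radius at most 1 the linear function oscillates by at most `2‖p‖ < 2r`, less than
  -- the gap between `V x₀` and the boundary values.
  have hxb : x ∈ ball 0 ρ := by
    by_contra hne
    have hs : x ∈ sphere 0 ρ := by
      rw [mem_sphere]; exact le_antisymm hx (not_lt.1 hne)
    linarith [hb x hs]
  have hloc : IsLocalMax (fun y => V y - innerSL ℝ p y) x :=
    (hmax.isLocalMax (Filter.mem_of_superset (isOpen_ball.mem_nhds hxb) ball_subset_closedBall))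
  refine ⟨x, hxb, by linarith, posSemidef_neg_hess_of_isLocalMax hV _ hloc, ?_⟩
  have hd : HasFDerivAt (fun y => V y - innerSL ℝ p y) (fderiv ℝ V x - innerSL ℝ p) x :=
    (hV.differentiable (by simp) x).hasFDerivAt.sub (innerSL ℝ p).hasFDerivAt
  exact sub_eq_zero.1 (hloc.hasFDerivAt_eq_zero hd)

/-- Positive semidefiniteness is an intersection of closed conditions, one per vector `ξ`. -/
lemma measurableSet_contact {V : EuclideanSpace ℝ (Fin n) → ℝ} (hV : ContDiff ℝ ∞ V) (ρ m : ℝ) :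
    MeasurableSet {x ∈ ball (0 : EuclideanSpace ℝ (Fin n)) ρ |
      m ≤ V x ∧ (-hess V x).PosSemidef} := by
  refine measurableSet_ball.inter (IsClosed.measurableSet ?_)
  refine (isClosed_le continuous_const hV.continuous).inter ?_
  have : {x | (-hess V x).PosSemidef}
      = ⋂ ξ : Fin n → ℝ, {x | 0 ≤ ξ ⬝ᵥ (-hess V x *ᵥ ξ)} := by
    ext x
    simp only [mem_ofPred_eq, mem_iInter, posSemidef_iff_dotProduct_mulVec, star_trivial,
      (isHermitian_hess hV x).neg, true_and]
  change IsClosed {x | (-hess V x).PosSemidef}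
  rw [this]
  refine isClosed_iInter fun ξ => isClosed_le continuous_const ?_
  exact continuous_const.dotProduct ((continuous_hess hV).neg.matrix_mulVec continuous_const)

/-- The Alexandrov–Bakelman–Pucci estimate for smooth functions. -/
lemma volume_ball_le_lintegral_det_hess {V : EuclideanSpace ℝ (Fin n) → ℝ} (hV : ContDiff ℝ ∞ V)
    {ρ b r : ℝ} (hρ : ρ ≤ 1) {x₀ : EuclideanSpace ℝ (Fin n)} (hx₀ : x₀ ∈ ball 0 ρ)
    (hb : ∀ y ∈ sphere 0 ρ, V y ≤ b) (hbr : b + 2 * r ≤ V x₀) :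
    volume (ball (0 : EuclideanSpace ℝ (Fin n)) r) ≤
      ∫⁻ x in {x ∈ ball 0 ρ | V x₀ - 2 * r ≤ V x ∧ (-hess V x).PosSemidef},
        ENNReal.ofReal (-hess V x).det := by
  set s := {x ∈ ball (0 : EuclideanSpace ℝ (Fin n)) ρ |
    V x₀ - 2 * r ≤ V x ∧ (-hess V x).PosSemidef}
  have hsm : MeasurableSet s := measurableSet_contact hV ρ _
  -- The gradient map: its Jacobian matrix is the Hessian, and it carries the contact set onto a set
  -- containing the ball of slopes.
  let F : EuclideanSpace ℝ (Fin n) → EuclideanSpace ℝ (Fin n) := fun x =>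
    WithLp.toLp 2 fun i => fderiv ℝ V x (EuclideanSpace.single i 1)
  have hFd : Differentiable ℝ F := by
    refine differentiable_euclidean.2 fun i => ?_
    exact ((hV.fderiv_right (m := 1) (by norm_cast)).differentiable one_ne_zero).clm_apply
      (differentiable_const _)
  have hdet : ∀ x, (fderiv ℝ F x).det = (hess V x).det := by
    intro x
    rw [ContinuousLinearMap.det,
      ← LinearMap.det_toMatrix (EuclideanSpace.basisFun (Fin n) ℝ).toBasis]
    congr 1
    ext i j
    rw [LinearMap.toMatrix_apply]
    have h := ((EuclideanSpace.proj (𝕜 := ℝ) i).hasFDerivAt.comp x (hFd x).hasFDerivAt).fderiv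
    have h2 := DFunLike.congr_fun h (EuclideanSpace.single j 1)
    simp only [hess, Matrix.of_apply]
    refine Eq.trans ?_ h2.symm
    simp
  have hsub : ball 0 r ⊆ F '' s := by
    intro p hp
    obtain ⟨x, hx, h1, h2, h3⟩ := exists_contact_point hV hρ hx₀ hb hbr (mem_ball_zero_iff.1 hp)
    refine ⟨x, ⟨hx, h1, h2⟩, ?_⟩
    ext i
    simp [F, h3, EuclideanSpace.inner_single_right]
  calc volume (ball (0 : EuclideanSpace ℝ (Fin n)) r) ≤ volume (F '' s) := measure_mono hsub
    _ ≤ ∫⁻ x in s, ENNReal.ofReal |(fderiv ℝ F x).det| :=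
        addHaar_image_le_lintegral_abs_det_fderiv volume hsm fun x _ =>
          (hFd x).hasFDerivAt.hasFDerivWithinAt
    _ = ∫⁻ x in s, ENNReal.ofReal (-hess V x).det := by
        refine setLIntegral_congr_fun hsm fun x hx => ?_
        have h : |(hess V x).det| = |(-hess V x).det| := by
          rw [det_neg, abs_mul, abs_pow, abs_neg, abs_one, one_pow, one_mul]
        simp only [hdet]
        rw [h, abs_of_nonneg hx.2.2.det_nonneg]

end NondivObstacle

namespace NondivObstacle

/-! ### The maximum principle -/

variable {n : ℕ}

/-- At points whose closed `φ.rOut`-neighbourhood stays in `ball 0 ρ`, the Hessian of the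
mollification is the mollification of the weak Hessian. -/
lemma hess_mollify {p : ℝ≥0∞} {u : EuclideanSpace ℝ (Fin n) → ℝ}
    {G : Fin n → EuclideanSpace ℝ (Fin n) → ℝ} {H : Fin n → Fin n → EuclideanSpace ℝ (Fin n) → ℝ}
    {Ω : Set (EuclideanSpace ℝ (Fin n))} (hΩ : MeasurableSet Ω) (hu : HasW2LocDerivs Ω p u G H)
    {ρ : ℝ} (hρ : closedBall 0 ρ ⊆ Ω) (φ : ContDiffBump (0 : EuclideanSpace ℝ (Fin n)))
    {x : EuclideanSpace ℝ (Fin n)} (hx : ‖x‖ + φ.rOut < ρ) (i j : Fin n) :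
    hess (mollify φ (indicator (closedBall 0 ρ) u)) x i j
      = mollify φ (indicator (closedBall 0 ρ) (H i j)) x := by
  -- The strict inequality gives the first-derivative identity on a neighbourhood, so it may be
  -- differentiated again.
  have hnhds : ∀ᶠ y in 𝓝 x, ‖y‖ + φ.rOut < ρ :=
    (continuous_norm.add continuous_const).continuousAt.eventually (gt_mem_nhds hx)
  have h : (fun y => fderiv ℝ (mollify φ (indicator (closedBall 0 ρ) u)) y
      (EuclideanSpace.single i 1)) =ᶠ[𝓝 x] mollify φ (indicator (closedBall 0 ρ) (G i)) := by
    filter_upwards [hnhds] with y hy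
    exact fderiv_mollify_indicator hΩ (hu.isWeakPartial_grad i) hρ φ hy.le
  simp only [hess, Matrix.of_apply]
  rw [h.fderiv_eq]
  exact fderiv_mollify_indicator hΩ (hu.isWeakPartial_hess i j) hρ φ hx.le

/-- The Alexandrov–Bakelman–Pucci maximum principle for strong subsolutions in the unit ball. -/
theorem le_of_subsolution (hn : 1 ≤ n) {lam Lam : ℝ}
    {a : EuclideanSpace ℝ (Fin n) → Matrix (Fin n) (Fin n) ℝ} (ha : IsUniformlyElliptic lam Lam a)
    {u : EuclideanSpace ℝ (Fin n) → ℝ} (huc : ContinuousOn u (closedBall 0 1))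
    {G : Fin n → EuclideanSpace ℝ (Fin n) → ℝ} {H : Fin n → Fin n → EuclideanSpace ℝ (Fin n) → ℝ}
    (hu : HasW2LocDerivs (ball 0 1) (n : ℝ≥0∞) u G H) {c : ℝ}
    (hLu : ∀ᵐ x ∂(volume.restrict (ball 0 1)), c < u x → 0 ≤ ∑ i, ∑ j, a x i j * H i j x)
    (hb : ∀ x ∈ sphere 0 1, u x ≤ c) : ∀ x ∈ ball 0 1, u x ≤ c := by
  by_contra! hcon
  obtain ⟨x₀, hx₀, hcx⟩ := hcon
  obtain ⟨M, hM⟩ : ∃ M, M = u x₀ - c := ⟨_, rfl⟩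
  have hM0 : 0 < M := by linarith
  -- The compact set `{u ≥ c + M/8}` misses the unit sphere, so it lies in a smaller ball. The gap
  -- between `ρ` and the `ρ'` chosen below leaves room for mollification.
  obtain ⟨ρ, hρ1, hρ⟩ : ∃ ρ < 1, ∀ x ∈ closedBall 0 1, c + M / 8 ≤ u x → ‖x‖ < ρ := by
    have hK : IsCompact (closedBall 0 1 ∩ u ⁻¹' Ici (c + M / 8)) :=
      (isCompact_closedBall 0 1).of_isClosed_subset
        (huc.preimage_isClosed_of_isClosed isClosed_closedBall isClosed_Ici) inter_subset_left
    obtain ⟨z, ⟨hz1, hz2⟩, hz⟩ := hK.exists_isMaxOn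
      ⟨x₀, ball_subset_closedBall hx₀, by simp only [mem_preimage, mem_Ici]; linarith⟩
      continuous_norm.continuousOn
    have hz3 : ‖z‖ < 1 := by
      refine lt_of_le_of_ne (mem_closedBall_zero_iff.1 hz1) fun h => ?_
      have := hb z (mem_sphere_zero_iff_norm.2 h)
      simp only [mem_preimage, mem_Ici] at hz2
      linarith
    refine ⟨(‖z‖ + 1) / 2, by linarith, fun x hx hux => ?_⟩
    have : ‖x‖ ≤ ‖z‖ := hz ⟨hx, hux⟩
    linarith
  have hx₀ρ : ‖x₀‖ < ρ := hρ x₀ (ball_subset_closedBall hx₀) (by linarith)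
  obtain ⟨ρ', hρρ', hρ'1⟩ := exists_between hρ1
  have hsub : closedBall (0 : EuclideanSpace ℝ (Fin n)) ρ' ⊆ ball 0 1 :=
    closedBall_subset_ball hρ'1
  obtain ⟨η, hη, hηu⟩ := Metric.uniformContinuousOn_iff.1
    ((isCompact_closedBall (0 : EuclideanSpace ℝ (Fin n)) ρ').uniformContinuousOn_of_continuous
      (huc.mono (hsub.trans ball_subset_closedBall))) (M / 8) (by positivity)
  let φ : ℕ → ContDiffBump (0 : EuclideanSpace ℝ (Fin n)) := fun k =>
    ⟨1 / ((k : ℝ) + 1) / 2, 1 / ((k : ℝ) + 1), by positivity, half_lt_self (by positivity)⟩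
  have hφ : Tendsto (fun k => (φ k).rOut) atTop (𝓝 0) := tendsto_one_div_add_atTop_nhds_zero_nat
  let uc : EuclideanSpace ℝ (Fin n) → ℝ := indicator (closedBall 0 ρ') u
  let Hc : Fin n → Fin n → EuclideanSpace ℝ (Fin n) → ℝ :=
    fun i j => indicator (closedBall 0 ρ') (H i j)
  have hn1 : (1 : ℝ≥0∞) ≤ n := by exact_mod_cast hn
  have huci : LocallyIntegrable uc volume :=
    ((memLp_indicator_iff_restrict measurableSet_closedBall).2
      (hu.memLpLoc _ (isCompact_closedBall _ _) hsub)).locallyIntegrable hn1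
  have hHc : ∀ i j, MemLp (Hc i j) n volume := fun i j =>
    (memLp_indicator_iff_restrict measurableSet_closedBall).2
      (hu.memLpLoc_hess i j _ (isCompact_closedBall _ _) hsub)
  let D : ℕ → EuclideanSpace ℝ (Fin n) → ℝ := fun k =>
    (Lam / lam) • ∑ i, ∑ j, fun x => ‖(mollify (φ k) (Hc i j) - Hc i j) x‖
  have hmeas : ∀ k i j, AEStronglyMeasurable (mollify (φ k) (Hc i j) - Hc i j)
      (volume.restrict (ball 0 ρ)) := fun k i j =>
    ((contDiff_mollify _ ((hHc i j).locallyIntegrable hn1)).continuous.aestronglyMeasurable.sub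
      (hHc i j).aestronglyMeasurable.restrict)
  have hDlim : Tendsto (fun k => eLpNorm (D k) n (volume.restrict (ball 0 ρ)) ^ n) atTop
      (𝓝 0) := by
    have h1 : Tendsto (fun k => ‖Lam / lam‖ₑ * ∑ i, ∑ j,
        eLpNorm (mollify (φ k) (Hc i j) - Hc i j) n (volume.restrict (ball 0 ρ))) atTop (𝓝 0) := by
      have h2 := tendsto_finsetSum Finset.univ fun i _ => tendsto_finsetSum Finset.univ
        fun j _ => tendsto_eLpNorm_mollify_sub hn1 (ENNReal.natCast_ne_top n) hφ (hHc i j)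
          (measure_ball_lt_top (μ := volume) (x := 0) (r := ρ)).ne
      simpa using ENNReal.Tendsto.const_mul h2 (Or.inr enorm_ne_top)
    have h3 : Tendsto (fun k => eLpNorm (D k) n (volume.restrict (ball 0 ρ))) atTop (𝓝 0) := by
      refine tendsto_of_tendsto_of_tendsto_of_le_of_le tendsto_const_nhds h1
        (fun _ => zero_le) fun k => ?_
      simp only [D]
      rw [eLpNorm_const_smul]
      gcongr
      refine (eLpNorm_sum_le (fun i _ => Finset.aestronglyMeasurable_sum _
        fun j _ => (hmeas k i j).norm) hn1).trans (Finset.sum_le_sum fun i _ => ?_)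
      refine (eLpNorm_sum_le (fun j _ => (hmeas k i j).norm) hn1).trans
        (Finset.sum_le_sum fun j _ => ?_)
      rw [eLpNorm_norm]
    have h4 := (ENNReal.continuous_pow n).continuousAt.tendsto.comp h3
    rwa [zero_pow (by omega)] at h4
  -- The quantifier over `B` sits inside the almost-everywhere statement, so `B` may be the Hessian
  -- of any mollification at `x`, with a null set independent of `k`.
  have hae : ∀ᵐ x ∂(volume.restrict (ball (0 : EuclideanSpace ℝ (Fin n)) 1)),
      c < u x → ∀ B : Matrix (Fin n) (Fin n) ℝ, (-B).PosSemidef →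
        (-B).det ≤ (Lam / lam * ∑ i, ∑ j, |B i j - H i j x|) ^ n := by
    filter_upwards [hLu, ha.isSymm, ha.bounds] with x h1 h2 h3 h4 B hB
    exact det_neg_le ha.pos h2 h3 hB (h1 h4)
  have hle : ∀ᶠ k in atTop, volume (ball (0 : EuclideanSpace ℝ (Fin n)) (M / 8))
      ≤ eLpNorm (D k) n (volume.restrict (ball 0 ρ)) ^ n := by
    filter_upwards [hφ.eventually (gt_mem_nhds hη),
      hφ.eventually (gt_mem_nhds (sub_pos.2 hρρ'))] with k hk1 hk2
    set V := mollify (φ k) uc with hV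
    have hVu : ∀ x ∈ closedBall (0 : EuclideanSpace ℝ (Fin n)) ρ, |V x - u x| ≤ M / 8 := by
      intro x hx
      have hx' : x ∈ closedBall (0 : EuclideanSpace ℝ (Fin n)) ρ' :=
        closedBall_subset_closedBall hρρ'.le hx
      have hux : uc x = u x := indicator_of_mem hx' u
      rw [← hux, ← Real.dist_eq]
      refine (φ k).dist_normed_convolution_le huci.aestronglyMeasurable fun y hy => ?_
      have hy' : y ∈ closedBall (0 : EuclideanSpace ℝ (Fin n)) ρ' := by
        rw [mem_closedBall_zero_iff] at hx ⊢
        have h1 := norm_le_norm_add_norm_sub' y x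
        rw [mem_ball, dist_eq_norm] at hy
        linarith
      rw [hux, show uc y = u y from indicator_of_mem hy' u]
      exact (hηu y hy' x hx' ((mem_ball.1 hy).trans hk1)).le
    have hx₀' := abs_le.1 (hVu x₀ (mem_closedBall_zero_iff.2 hx₀ρ.le))
    have hsphere : ∀ y ∈ sphere (0 : EuclideanSpace ℝ (Fin n)) ρ, V y ≤ c + M / 4 := by
      intro y hy
      have h1 := abs_le.1 (hVu y (sphere_subset_closedBall hy))
      rw [mem_sphere_zero_iff_norm] at hy
      have h2 : u y < c + M / 8 := by
        by_contra! h
        exact (hρ y (mem_closedBall_zero_iff.2 (by linarith)) h).ne hy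
      linarith
    -- With `|V - u| ≤ M/8`, the peak satisfies `V x₀ ≥ c + 7M/8`, while `V ≤ c + M/4` on the
    -- sphere, so slopes up to `r = M/8` are admissible. At contact points `V ≥ c + 5M/8`, hence `u
    -- ≥ c + M/2 > c`, where the subsolution inequality is available.
    have hest := volume_ball_le_lintegral_det_hess (contDiff_mollify (φ k) huci) hρ1.le
      (mem_ball_zero_iff.2 hx₀ρ) hsphere (r := M / 8) (by linarith)
    refine hest.trans ?_
    have hn0 : (n : ℝ≥0∞) ≠ 0 := (zero_lt_one.trans_le hn1).ne'
    rw [eLpNorm_eq_lintegral_rpow_enorm_toReal hn0 (ENNReal.natCast_ne_top n),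
      ← ENNReal.rpow_natCast, ← ENNReal.rpow_mul, ENNReal.toReal_natCast,
      one_div_mul_cancel (by positivity), ENNReal.rpow_one]
    simp_rw [ENNReal.rpow_natCast]
    set s := {x ∈ ball (0 : EuclideanSpace ℝ (Fin n)) ρ |
      V x₀ - 2 * (M / 8) ≤ V x ∧ (-hess V x).PosSemidef}
    have hsρ : s ⊆ ball 0 ρ := fun x hx => hx.1
    refine le_trans (lintegral_mono_ae ?_) (lintegral_mono_set hsρ)
    have hs0 : ∀ᵐ x ∂(volume.restrict s), x ∈ s :=
      ae_restrict_mem (measurableSet_contact (contDiff_mollify (φ k) huci) ρ _)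
    filter_upwards [hs0, ae_mono (Measure.restrict_mono
      (hsρ.trans (ball_subset_ball hρ1.le)) le_rfl) hae] with x hxs hx
    have h1 := abs_le.1 (hVu x (ball_subset_closedBall hxs.1))
    have h2 := hx (by linarith [hxs.2.1]) _ hxs.2.2
    have hxρ : ‖x‖ < ρ := mem_ball_zero_iff.1 hxs.1
    have hDx : Lam / lam * ∑ i, ∑ j, |hess V x i j - H i j x| = D k x := by
      simp only [D, Pi.smul_apply, Finset.sum_apply, smul_eq_mul, Pi.sub_apply, Real.norm_eq_abs]
      refine congrArg _ (Finset.sum_congr rfl fun i _ => Finset.sum_congr rfl fun j _ => ?_)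
      rw [hess_mollify measurableSet_ball hu hsub (φ k) (by linarith) i j,
        show Hc i j x = H i j x from
          indicator_of_mem (mem_closedBall_zero_iff.2 (by linarith)) (H i j)]
    rw [hDx] at h2
    calc ENNReal.ofReal (-hess V x).det ≤ ENNReal.ofReal (D k x ^ n) := ENNReal.ofReal_le_ofReal h2
      _ ≤ ‖D k x ^ n‖ₑ := Real.ofReal_le_enorm _
      _ = ‖D k x‖ₑ ^ n := enorm_pow _ _
  exact (measure_ball_pos volume (0 : EuclideanSpace ℝ (Fin n)) (by positivity)).not_ge
    (ge_of_tendsto hDlim hle)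

/-- Comparison for the obstacle problem: a solution lies below another one up to the constant by
which it does so on the boundary. -/
lemma IsSolution.sub_le (hn : 1 ≤ n) {lam Lam : ℝ}
    {a : EuclideanSpace ℝ (Fin n) → Matrix (Fin n) (Fin n) ℝ} (ha : IsUniformlyElliptic lam Lam a)
    {v w : EuclideanSpace ℝ (Fin n) → ℝ} (hv : IsSolution a v) (hw : IsSolution a w) {c : ℝ}
    (hc : 0 ≤ c) (hb : ∀ x ∈ sphere 0 1, v x - w x ≤ c) : ∀ x ∈ ball 0 1, v x - w x ≤ c := by
  obtain ⟨G, H, hvd, hve⟩ := hv.strong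
  obtain ⟨G', H', hwd, hwe⟩ := hw.strong
  refine le_of_subsolution hn ha (hv.continuousOn.sub hw.continuousOn) (hvd.sub hwd) ?_ hb
  filter_upwards [hve, hwe, ae_restrict_mem measurableSet_ball] with x h1 h2 hx hlt
  have hw0 := hw.nonneg x hx
  -- Here `v > w + c ≥ 0`, so the right-hand side for `v` is 1, which dominates the indicator for
  -- `w`.
  have hv0 : x ∈ {y | 0 < v y} := by
    simp only [Pi.sub_apply] at hlt
    simp only [mem_ofPred_eq]
    linarith
  rw [indicator_of_mem hv0] at h1
  simp only [Pi.sub_apply, mul_sub, Finset.sum_sub_distrib]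
  rw [h1, h2, sub_nonneg]
  exact indicator_le_self' (fun _ _ => zero_le_one) x

end NondivObstacle

theorem theorem4p3 (n : ℕ) (hn : 1 ≤ n) (lam Lam : ℝ)
    (a : EuclideanSpace ℝ (Fin n) → Matrix (Fin n) (Fin n) ℝ)
    (ha : NondivObstacle.IsUniformlyElliptic lam Lam a) :
    (∀ (w₁ w₂ : EuclideanSpace ℝ (Fin n) → ℝ) (ε : ℝ),
      NondivObstacle.IsSolution a w₁ → NondivObstacle.IsSolution a w₂ →
      (∀ x ∈ Metric.sphere (0 : EuclideanSpace ℝ (Fin n)) 1, w₁ x ≤ w₂ x ∧ w₂ x ≤ w₁ x + ε) →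
      ∀ x ∈ Metric.ball (0 : EuclideanSpace ℝ (Fin n)) 1, w₁ x ≤ w₂ x ∧ w₂ x ≤ w₁ x + ε) ∧
    (∀ (ψ w₁ w₂ : EuclideanSpace ℝ (Fin n) → ℝ),
      NondivObstacle.IsSolution a w₁ → NondivObstacle.IsSolution a w₂ →
      (∀ x ∈ Metric.sphere (0 : EuclideanSpace ℝ (Fin n)) 1, w₁ x = ψ x) →
      (∀ x ∈ Metric.sphere (0 : EuclideanSpace ℝ (Fin n)) 1, w₂ x = ψ x) →
      ∀ x ∈ Metric.closedBall (0 : EuclideanSpace ℝ (Fin n)) 1, w₁ x = w₂ x) := by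
  have comparison : ∀ (w₁ w₂ : EuclideanSpace ℝ (Fin n) → ℝ) (ε : ℝ),
      NondivObstacle.IsSolution a w₁ → NondivObstacle.IsSolution a w₂ →
      (∀ x ∈ Metric.sphere (0 : EuclideanSpace ℝ (Fin n)) 1, w₁ x ≤ w₂ x ∧ w₂ x ≤ w₁ x + ε) →
      ∀ x ∈ Metric.ball (0 : EuclideanSpace ℝ (Fin n)) 1, w₁ x ≤ w₂ x ∧ w₂ x ≤ w₁ x + ε := by
    intro w₁ w₂ ε h₁ h₂ hb x hx
    -- As `n ≥ 1`, the sphere is nonempty, and the boundary inequalities at one of its points force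
    -- the sign of `ε`.
    have hε : 0 ≤ ε := by
      have := hb (EuclideanSpace.single ⟨0, hn⟩ 1) (by simp)
      linarith
    have hle := h₁.sub_le hn ha h₂ le_rfl (fun y hy => by linarith [(hb y hy).1]) x hx
    have hge := h₂.sub_le hn ha h₁ hε (fun y hy => by linarith [(hb y hy).2]) x hx
    exact ⟨by linarith, by linarith⟩
  refine ⟨comparison, fun ψ w₁ w₂ h₁ h₂ hψ₁ hψ₂ x hx => ?_⟩
  have hb : ∀ y ∈ Metric.sphere (0 : EuclideanSpace ℝ (Fin n)) 1, w₁ y = w₂ y := fun y hy =>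
    (hψ₁ y hy).trans (hψ₂ y hy).symm
  rcases (Metric.mem_closedBall.1 hx).lt_or_eq with hlt | heq
  · have h := comparison w₁ w₂ 0 h₁ h₂
      (fun y hy => ⟨(hb y hy).le, by simpa using (hb y hy).ge⟩) x hlt
    exact le_antisymm h.1 (by simpa using h.2)
  · exact hb x heq
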